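/- All graphs are finite, simple and undirected. For a connected graph $G$ with vertex set $V(G)$, let $d_G(u,v)$ be the distance between $u$ and $v$, let $D(G)=(d_G(u,v))_{u,v\in V(G)}$ be the distance matrix, and let $T(G)$ be the diagonal matrix whose entry at $u$ is the transmission $T_G(u)=\sum_{v\in V(G)}d_G(u,v)$. For $\alpha\in[0,1)$, the distance $\alpha$-spectral radius $\mu_\alpha(G)$ is the largest eigenvalue of the real symmetric matrix $D_\alpha(G)=\alpha T(G)+(1-\alpha)D(G)$. Let $P_n$ be the path on $n$ vertices, and for $n\ge 4$ let $B_{n,3}$ be the tree of order $n$ obtained by attaching two pendant vertices to a terminal vertex of the path $P_{n-2}$. **Theorem.** Let $\alpha\in[0,1)$ and let $G$ be a connected graph of order $n\ge 4$ with $G\not\cong P_n$. Then \[ \mu_\alpha(G)\le\mu_\alpha(B_{n,3})<\mu_\alpha(P_n), \] and $\mu_\alpha(G)=\mu_\alpha(B_{n,3})$ if and only if $G\cong B_{n,3}$. Consequently, among connected graphs of order $n\ge 4$, $P_n$ is the unique graph with the largest distance $\alpha$-spectral radius and $B_{n,3}$ is the unique graph with the second largest: that is, $P_n$ is connected, every connected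 graph $G$ of order $n$ satisfies $\mu_\alpha(G)\le\mu_\alpha(P_n)$ with equality if and only if $G\cong P_n$, and $B_{n,3}$ is connected and not isomorphic to $P_n$. -/

import Mathlib

namespace DistAlpha

/-- The distance matrix `D(G)`, with entries the graph distances `d_G(u, v)`. -/
noncomputable def distMatrix {V : Type*} (G : SimpleGraph V) : Matrix V V ℝ :=
  Matrix.of fun u v => (G.dist u v : ℝ)

/-- The transmission `T_G(u)`: the sum of the distances from `u` to all vertices. -/
noncomputable def transmission {V : Type*} [Fintype V] (G : SimpleGraph V) (u : V) : ℝ :=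
  ∑ v, (G.dist u v : ℝ)

/-- The matrix `D_α(G) = α T(G) + (1 - α) D(G)`, where `T(G)` is the diagonal matrix of
transmissions. -/
noncomputable def distAlphaMatrix {V : Type*} [Fintype V] [DecidableEq V]
    (α : ℝ) (G : SimpleGraph V) : Matrix V V ℝ :=
  α • Matrix.diagonal (transmission G) + (1 - α) • distMatrix G

theorem distAlphaMatrix_isHermitian {V : Type*} [Fintype V] [DecidableEq V]
    (α : ℝ) (G : SimpleGraph V) : (distAlphaMatrix α G).IsHermitian := by
  ext u v
  by_cases h : u = v
  · subst h
    simp [distAlphaMatrix, distMatrix]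
  · simp [distAlphaMatrix, distMatrix, Matrix.diagonal_apply_ne _ h,
      Matrix.diagonal_apply_ne _ (Ne.symm h), G.dist_comm]

/-- The distance `α`-spectral radius `μ_α(G)`: the largest eigenvalue of the real symmetric
matrix `D_α(G)` (a maximum over a finite family, nonempty whenever `V` is). -/
noncomputable def spectralRadius {V : Type*} [Fintype V] [DecidableEq V]
    (α : ℝ) (G : SimpleGraph V) : ℝ :=
  ⨆ i : V, (distAlphaMatrix_isHermitian α G).eigenvalues i

/-- The graph `B_{n,Δ}` (for `2 ≤ Δ ≤ n - 1`): the vertices `0, 1, …, n - Δ` form the path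
`P_{n-Δ+1}` in this order, and each of the remaining `Δ - 1` vertices is a pendant vertex attached
to the terminal vertex `n - Δ` of that path. -/
def broom (n Δ : ℕ) : SimpleGraph (Fin n) :=
  SimpleGraph.fromRel fun i j =>
    (j.val ≤ n - Δ ∧ i.val + 1 = j.val) ∨ (n - Δ < j.val ∧ i.val = n - Δ)

end DistAlpha

/-! For fixed `x`, the quadratic form of `D_α(G)` is a sum of distances with weights `formWeight α
x`, positive when `x` is. If `x` is a Perron vector of `G` and `H` has a larger sum for these
weights, then `H` has a larger spectral radius. So it suffices to find the maximisers of an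
arbitrary positively weighted distance sum.

A maximiser is a tree, since deleting edges lengthens distances. If `u` has neighbours `a`, `b`, `c`
in a tree, detach the branch at `c` and hang it on `a` or on `b`: the two new sums average to more
than the old one (`two_mul_weightedDist_lt`), so one slide is an improvement. Hence maximisers over
all connected graphs are paths. Over connected graphs with a vertex of degree at least three, the
improving slide must destroy all branching, which forces the broom.

A connected graph without branching that is not a path is a cycle. Its transmissions are at most `n
^ 2 / 4`, which bounds its radius, and the mean transmission of the broom is larger. -/

namespace DistAlpha

open SimpleGraph

/-! ### Distances and cut edges -/

section Graph

variable {V : Type*} {G H : SimpleGraph V}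

/-- A function that grows by at most one along each edge is bounded by the distance. -/
theorem le_add_dist_of_adj (hG : G.Connected) (f : V → ℕ)
    (hf : ∀ x y, G.Adj x y → f y ≤ f x + 1) (p q : V) : f q ≤ f p + G.dist p q := by
  obtain ⟨w, hw⟩ := hG.exists_walk_length_eq_dist p q
  rw [← hw]
  clear hw
  induction w with
  | nil => simp
  | cons h w ih =>
    have := hf _ _ h
    simp only [Walk.length_cons]
    omega

theorem dist_le_dist_add_one (hG : G.Connected) (p : V) {x y : V} (h : G.Adj x y) :
    G.dist p y ≤ G.dist p x + 1 := by
  have := hG.dist_triangle (u := p) (v := x) (w := y)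
  rwa [dist_eq_one_iff_adj.2 h] at this

theorem exists_adj_dist_add_one_eq (hG : G.Connected) {r v : V} (h : v ≠ r) :
    ∃ p, G.Adj p v ∧ G.dist r p + 1 = G.dist r v := by
  obtain ⟨w, hw⟩ := hG.exists_walk_length_eq_dist v r
  cases w with
  | nil => exact absurd rfl h
  | cons h' w =>
    rename_i p
    refine ⟨p, h'.symm, ?_⟩
    have h1 := dist_le w
    have h2 := dist_le_dist_add_one hG r h'.symm
    rw [Walk.length_cons] at hw
    rw [G.dist_comm (u := r) (v := p), G.dist_comm (u := r) (v := v)] at *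
    omega

/-- Some vertex has at least three neighbours. -/
def Branching (G : SimpleGraph V) : Prop :=
  ∃ u a b c, G.Adj u a ∧ G.Adj u b ∧ G.Adj u c ∧ a ≠ b ∧ a ≠ c ∧ b ≠ c

theorem Branching.map_iso {V' : Type*} {G' : SimpleGraph V'} (e : G ≃g G') (h : Branching G) :
    Branching G' := by
  obtain ⟨u, a, b, c, ha, hb, hc, hab, hac, hbc⟩ := h
  exact ⟨e u, e a, e b, e c, e.map_adj_iff.2 ha, e.map_adj_iff.2 hb, e.map_adj_iff.2 hc,
    e.injective.ne hab, e.injective.ne hac, e.injective.ne hbc⟩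

/-- The edge `pq` is the only edge between `S` and its complement, with `p ∈ S`. -/
structure IsCutEdge (G : SimpleGraph V) (S : Set V) (p q : V) : Prop where
  left_mem : p ∈ S
  right_notMem : q ∉ S
  adj : G.Adj p q
  unique : ∀ x y, G.Adj x y → x ∈ S → y ∉ S → x = p ∧ y = q

/-- Every walk leaving `S` passes through `q`. Formally, the right potential grows by at most one
per edge, as in all lower bounds on distances below. -/
theorem IsCutEdge.dist_add_le (hG : G.Connected) {S : Set V} {p q : V} (h : IsCutEdge G S p q)
    {x y : V} (hx : x ∈ S) (hy : y ∉ S) : G.dist x q + G.dist q y ≤ G.dist x y := by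
  classical
  have key := le_add_dist_of_adj hG
    (fun z => if z ∈ S then G.dist x z else G.dist x q + G.dist q z) (fun z t hzt => ?_) x y
  · simpa [hx, hy] using key
  · have h1 := dist_le_dist_add_one hG x hzt
    have h2 := dist_le_dist_add_one hG q hzt
    by_cases hz : z ∈ S <;> by_cases ht : t ∈ S <;> simp only [hz, ht, if_true, if_false]
    · exact h1
    · obtain ⟨rfl, rfl⟩ := h.unique _ _ hzt hz ht
      simpa using h1
    · obtain ⟨rfl, rfl⟩ := h.unique _ _ hzt.symm ht hz
      have h3 := dist_le_dist_add_one hG x hzt.symm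
      have h4 := h.adj
      simp only [dist_self]
      omega
    · omega

theorem exists_isCutEdge_of_isTree (hG : G.IsTree) {p q : V} (hpq : G.Adj p q) :
    ∃ S, IsCutEdge G S p q := by
  have hb := isAcyclic_iff_forall_adj_isBridge.1 hG.isAcyclic hpq
  rw [isBridge_iff] at hb
  -- `S` is the component of `p` once the bridge `pq` is deleted.
  refine ⟨{v | (G.deleteEdges {s(p, q)}).Reachable p v}, Reachable.refl _, hb, hpq, ?_⟩
  intro x y hxy hx hy
  by_contra hne
  by_cases he : s(x, y) = s(p, q)
  · rw [Sym2.eq_iff] at he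
    rcases he with he | ⟨rfl, rfl⟩
    · exact hne he
    · exact hb hx
  · exact hy (Reachable.trans hx (Adj.reachable (by simp [deleteEdges_adj, hxy, he])))

/-- If `a ≠ b` are neighbours of `u` and `ua` is a cut edge, then moving from `u` to `a` and to `b`
changes the distance to any vertex by a nonnegative total. -/
theorem two_mul_dist_le (hG : G.Connected) {S : Set V} {a u b : V} (h : IsCutEdge G S a u)
    (hub : G.Adj u b) (hab : a ≠ b) (v : V) : 2 * G.dist u v ≤ G.dist a v + G.dist b v := by
  have hb : b ∉ S := fun hb => hab (h.unique _ _ hub.symm hb h.right_notMem).1.symm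
  have h1 := dist_le_dist_add_one hG v hub.symm
  have h2 := dist_le_dist_add_one hG v h.adj
  simp only [G.dist_comm (u := v)] at h1 h2
  -- On the side of `a`, moving to `b` gains exactly one and moving to `a` loses at most one; on the
  -- other side the roles are exchanged.
  by_cases hv : v ∈ S
  · have h3 := h.dist_add_le hG hv hb
    rw [dist_eq_one_iff_adj.2 hub, G.dist_comm, G.dist_comm (u := v) (v := b)] at h3
    omega
  · have h3 := h.dist_add_le hG h.left_mem hv
    rw [dist_eq_one_iff_adj.2 h.adj] at h3
    omega

/-! ### Sliding a branch to a neighbouring vertex -/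

/-- Remove the edges between `C` and its complement, and join `c ∈ C` to `a ∉ C`. -/
def slide (G : SimpleGraph V) (C : Set V) (c a : V) (hc : c ∈ C) (ha : a ∉ C) : SimpleGraph V where
  Adj x y := (G.Adj x y ∧ (x ∈ C ↔ y ∈ C)) ∨ (x = c ∧ y = a) ∨ (x = a ∧ y = c)
  symm := ⟨fun x y h => by
    rcases h with h | h | h
    · exact Or.inl ⟨h.1.symm, h.2.symm⟩
    · exact Or.inr (Or.inr h.symm)
    · exact Or.inr (Or.inl h.symm)⟩
  loopless := ⟨fun x h => by
    rcases h with h | ⟨rfl, rfl⟩ | ⟨rfl, rfl⟩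
    · exact G.loopless.irrefl x h.1
    · exact ha hc
    · exact ha hc⟩

theorem slide_adj_of_ne {C : Set V} {c u a : V} (h : IsCutEdge G C c u) {ha : a ∉ C} {x y : V}
    (hxy : G.Adj x y) (h1 : ¬ (x = c ∧ y = u)) (h2 : ¬ (x = u ∧ y = c)) :
    (slide G C c a h.left_mem ha).Adj x y := by
  refine Or.inl ⟨hxy, ?_⟩
  by_contra hne
  by_cases hx : x ∈ C
  · exact h1 (h.unique _ _ hxy hx (by tauto))
  · exact h2 (h.unique _ _ hxy.symm (by tauto) hx).symm

theorem slide_connected (hG : G.Connected) {C : Set V} {c u a : V} (h : IsCutEdge G C c u)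
    (ha : a ∉ C) : (slide G C c a h.left_mem ha).Connected := by
  set G' := slide G C c a h.left_mem ha
  -- Follow a walk of `G` from `c`: steps within one side survive, and a crossing can only use `cu`,
  -- where the claim restarts trivially.
  have key : ∀ q, (q ∈ C → G'.Reachable c q) ∧ (q ∉ C → G'.Reachable u q) := by
    intro q
    have hr := hG.preconnected c q
    rw [reachable_iff_reflTransGen] at hr
    induction hr with
    | refl => exact ⟨fun _ => Reachable.refl _, fun hc => absurd h.left_mem hc⟩
    | tail _ hxy ih =>
      rename_i x y _
      by_cases hx : x ∈ C <;> by_cases hy : y ∈ C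
      · exact ⟨fun _ => (ih.1 hx).trans (Adj.reachable (Or.inl ⟨hxy, by tauto⟩)),
          fun hy' => absurd hy hy'⟩
      · obtain ⟨rfl, rfl⟩ := h.unique _ _ hxy hx hy
        exact ⟨fun hy' => absurd hy' hy, fun _ => Reachable.refl _⟩
      · obtain ⟨rfl, rfl⟩ := h.unique _ _ hxy.symm hy hx
        exact ⟨fun _ => Reachable.refl _, fun hy' => absurd hy hy'⟩
      · exact ⟨fun hy' => absurd hy' hy,
          fun _ => (ih.2 hx).trans (Adj.reachable (Or.inl ⟨hxy, by tauto⟩))⟩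
  have hca : G'.Adj c a := Or.inr (Or.inl ⟨rfl, rfl⟩)
  have huc : G'.Reachable u c := ((key a).2 ha).trans hca.symm.reachable
  have hall : ∀ q, G'.Reachable c q := fun q => by
    by_cases hq : q ∈ C
    · exact (key q).1 hq
    · exact huc.symm.trans ((key q).2 hq)
  have : Nonempty V := ⟨c⟩
  exact ⟨fun p q => (hall p).symm.trans (hall q)⟩

/-- After the slide, `ca` is the only way out of `C`. -/
theorem dist_le_slide_dist_of_mem (hG : G.Connected) {C : Set V} {c u a : V}
    (h : IsCutEdge G C c u) (ha : a ∉ C) {p q : V} (hp : p ∈ C) :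
    (q ∈ C → G.dist p q ≤ (slide G C c a h.left_mem ha).dist p q) ∧
    (q ∉ C → G.dist p c + 1 + G.dist a q ≤ (slide G C c a h.left_mem ha).dist p q) := by
  classical
  have key := le_add_dist_of_adj (slide_connected hG h ha)
    (fun z => if z ∈ C then G.dist p z else G.dist p c + 1 + G.dist a z) (fun z t hzt => ?_) p q
  · constructor <;> intro hq <;> simpa [hp, hq] using key
  · rcases hzt with ⟨hzt, hC⟩ | ⟨rfl, rfl⟩ | ⟨rfl, rfl⟩
    · have h1 := dist_le_dist_add_one hG p hzt
      have h2 := dist_le_dist_add_one hG a hzt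
      by_cases hz : z ∈ C
      · simpa [hz, hC.1 hz] using h1
      · have ht : t ∉ C := fun ht => hz (hC.2 ht)
        simp only [hz, ht, if_false]
        omega
    · simp [h.left_mem, ha]
    · simp only [h.left_mem, ha, if_true, if_false]
      omega

theorem dist_le_slide_dist_of_notMem (hG : G.Connected) {C : Set V} {c u a : V}
    (h : IsCutEdge G C c u) (ha : a ∉ C) {p q : V} (hp : p ∉ C) (hq : q ∉ C) :
    G.dist p q ≤ (slide G C c a h.left_mem ha).dist p q := by
  classical
  have key := le_add_dist_of_adj (slide_connected hG h ha)
    -- Collapsing `C` to `a` shows that a detour through `C` is no shortcut.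
    (fun z => if z ∈ C then G.dist p a else G.dist p z) (fun z t hzt => ?_) p q
  · simpa [hp, hq] using key
  · rcases hzt with ⟨hzt, hC⟩ | ⟨rfl, rfl⟩ | ⟨rfl, rfl⟩
    · have h1 := dist_le_dist_add_one hG p hzt
      by_cases hz : z ∈ C
      · simp [hz, hC.1 hz]
      · have ht : t ∉ C := fun ht => hz (hC.2 ht)
        simpa [hz, ht] using h1
    · simp [h.left_mem, ha]
    · simp [h.left_mem, ha]

/-- Distances within either side do not drop. Across, the route now goes through `a` or `b` in place
of `u`, and `two_mul_dist_le` says that this costs nothing on average. -/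
theorem two_mul_dist_le_slide_add_slide (hG : G.Connected) {C S : Set V} {c u a b : V}
    (h : IsCutEdge G C c u) (hS : IsCutEdge G S a u) (hub : G.Adj u b) (hab : a ≠ b)
    (ha : a ∉ C) (hb : b ∉ C) (p q : V) :
    2 * G.dist p q ≤ (slide G C c a h.left_mem ha).dist p q +
      (slide G C c b h.left_mem hb).dist p q := by
  have cross : ∀ p q, p ∈ C → q ∉ C → 2 * G.dist p q ≤
      (slide G C c a h.left_mem ha).dist p q + (slide G C c b h.left_mem hb).dist p q := by
    intro p q hp hq
    have h1 := (dist_le_slide_dist_of_mem hG h ha hp (q := q)).2 hq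
    have h2 := (dist_le_slide_dist_of_mem hG h hb hp (q := q)).2 hq
    have h3 := two_mul_dist_le hG hS hub hab q
    have h4 := dist_le_dist_add_one hG p h.adj
    have h5 := hG.dist_triangle (u := p) (v := u) (w := q)
    omega
  by_cases hp : p ∈ C <;> by_cases hq : q ∈ C
  · have h1 := (dist_le_slide_dist_of_mem hG h ha hp (q := q)).1 hq
    have h2 := (dist_le_slide_dist_of_mem hG h hb hp (q := q)).1 hq
    omega
  · exact cross p q hp hq
  · simpa only [SimpleGraph.dist_comm (u := p) (v := q)] using cross q p hq hp
  · have h1 := dist_le_slide_dist_of_notMem hG h ha hp hq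
    have h2 := dist_le_slide_dist_of_notMem hG h hb hp hq
    omega

theorem two_mul_dist_lt_slide_add_slide (hG : G.Connected) {C : Set V} {c u a b : V}
    (h : IsCutEdge G C c u) (hua : G.Adj u a) (hub : G.Adj u b) (ha : a ∉ C) (hb : b ∉ C) :
    2 * G.dist c u < (slide G C c a h.left_mem ha).dist c u +
      (slide G C c b h.left_mem hb).dist c u := by
  have h1 := (dist_le_slide_dist_of_mem hG h ha h.left_mem (q := u)).2 h.right_notMem
  have h2 := (dist_le_slide_dist_of_mem hG h hb h.left_mem (q := u)).2 h.right_notMem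
  rw [dist_eq_one_iff_adj.2 hua.symm] at h1
  rw [dist_eq_one_iff_adj.2 hub.symm] at h2
  rw [dist_eq_one_iff_adj.2 h.adj]
  omega

/-! ### Weighted distance sums -/

/-- Weighted sum of the distances. -/
noncomputable def weightedDist [Fintype V] (w : V → V → ℝ) (G : SimpleGraph V) : ℝ :=
  ∑ u, ∑ v, w u v * G.dist u v

theorem weightedDist_lt_of_le [Fintype V] {w : V → V → ℝ} (hw : ∀ u v, 0 < w u v)
    (hH : H.Connected) (hle : H ≤ G) (hne : H ≠ G) : weightedDist w G < weightedDist w H := by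
  have hle' : ∀ u v, w u v * (G.dist u v : ℝ) ≤ w u v * H.dist u v := fun u v =>
    mul_le_mul_of_nonneg_left (by exact_mod_cast (hH.preconnected u v).dist_anti hle) (hw u v).le
  obtain ⟨u, v, hG, hnH⟩ : ∃ u v, G.Adj u v ∧ ¬ H.Adj u v := by
    by_contra! hcon
    exact hne (le_antisymm hle hcon)
  refine Finset.sum_lt_sum (fun u _ => Finset.sum_le_sum fun v _ => hle' u v)
    ⟨u, Finset.mem_univ _, Finset.sum_lt_sum (fun v _ => hle' u v) ⟨v, Finset.mem_univ _, ?_⟩⟩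
  refine mul_lt_mul_of_pos_left ?_ (hw u v)
  rw [dist_eq_one_iff_adj.2 hG]
  exact_mod_cast hH.one_lt_dist_of_ne_of_not_adj hG.ne hnH

theorem two_mul_weightedDist_lt [Fintype V] {w : V → V → ℝ} (hw : ∀ u v, 0 < w u v)
    (hG : G.Connected) {C S : Set V} {c u a b : V}
    (h : IsCutEdge G C c u) (hS : IsCutEdge G S a u) (hub : G.Adj u b) (hab : a ≠ b)
    (ha : a ∉ C) (hb : b ∉ C) :
    2 * weightedDist w G < weightedDist w (slide G C c a h.left_mem ha) +
      weightedDist w (slide G C c b h.left_mem hb) := by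
  simp only [weightedDist, Finset.mul_sum, ← Finset.sum_add_distrib]
  have hle : ∀ p q, 2 * (w p q * (G.dist p q : ℝ)) ≤
      w p q * (slide G C c a h.left_mem ha).dist p q +
      w p q * (slide G C c b h.left_mem hb).dist p q := fun p q => by
    have : (2 * G.dist p q : ℝ) ≤ (slide G C c a h.left_mem ha).dist p q +
      (slide G C c b h.left_mem hb).dist p q := by
      exact_mod_cast two_mul_dist_le_slide_add_slide hG h hS hub hab ha hb p q
    have := mul_le_mul_of_nonneg_left this (hw p q).le
    linarith
  refine Finset.sum_lt_sum (fun p _ => Finset.sum_le_sum fun q _ => hle p q)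
    ⟨c, Finset.mem_univ _, Finset.sum_lt_sum (fun q _ => hle c q) ⟨u, Finset.mem_univ _, ?_⟩⟩
  have : (2 * G.dist c u : ℝ) < (slide G C c a h.left_mem ha).dist c u +
      (slide G C c b h.left_mem hb).dist c u := by
    exact_mod_cast two_mul_dist_lt_slide_add_slide hG h hS.adj.symm hub ha hb
  have := mul_lt_mul_of_pos_left this (hw c u)
  linarith

/-- Extends the star at `u` to a spanning tree, so that a branching at `u` survives the passage to a
tree. -/
theorem exists_isTree_le_adj (hG : G.Connected) (u : V) :
    ∃ T ≤ G, T.IsTree ∧ ∀ y, G.Adj u y → T.Adj u y := by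
  obtain ⟨T, h1, h2, h3⟩ := hG.exists_isTree_le_of_le_of_isAcyclic
    (H := G ⊓ starGraph u) inf_le_left ((isAcyclic_starGraph u).anti inf_le_right)
  exact ⟨T, h2, h3, fun y hy => h1 ⟨hy, by simp [hy.ne]⟩⟩

/-! ### Recognising paths -/

theorem not_branching_iff : ¬ Branching G ↔ ∀ u a b c, G.Adj u a → G.Adj u b → G.Adj u c →
    a = b ∨ a = c ∨ b = c := by
  simp only [Branching]
  push Not
  grind

theorem exists_equiv_fin_dist [Fintype V] (hG : G.Connected) (hB : ¬ Branching G) {r : V}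
    (hr : ∀ x y, G.Adj r x → G.Adj r y → x = y) {n : ℕ} (hn : Fintype.card V = n) :
    ∃ e : V ≃ Fin n, (∀ v, (e v : ℕ) = G.dist r v) ∧
      ∀ x y, G.Adj x y ↔ (e x : ℕ) + 1 = e y ∨ (e y : ℕ) + 1 = e x := by
  rw [not_branching_iff] at hB
  -- Each distance level holds at most one vertex: a vertex other than `r` spends one of its two
  -- possible neighbours on the previous level, and `r` has at most one neighbour.
  have hinj : ∀ k x y, G.dist r x = k → G.dist r y = k → x = y := by
    intro k
    induction k with
    | zero =>
      intro x y hx hy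
      rw [← hG.dist_eq_zero_iff.1 hx, ← hG.dist_eq_zero_iff.1 hy]
    | succ k ih =>
      intro x y hx hy
      obtain ⟨p, hpx, hp⟩ := exists_adj_dist_add_one_eq hG (r := r) (v := x)
        (by rintro rfl; simp at hx)
      obtain ⟨p', hpy, hp'⟩ := exists_adj_dist_add_one_eq hG (r := r) (v := y)
        (by rintro rfl; simp at hy)
      obtain rfl := ih p p' (by omega) (by omega)
      by_cases hpr : p = r
      · subst hpr
        exact hr _ _ hpx hpy
      · obtain ⟨q, hqp, hq⟩ := exists_adj_dist_add_one_eq hG hpr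
        rcases hB p q x y hqp.symm hpx hpy with rfl | rfl | h
        · omega
        · omega
        · exact h
  have hlt : ∀ v, G.dist r v < n := fun v => by
    obtain ⟨w, hw, hl⟩ := hG.exists_path_of_dist r v
    rw [← hl, ← hn]
    exact hw.length_lt
  have hb : Function.Bijective (fun v => (⟨G.dist r v, hlt v⟩ : Fin n)) := by
    rw [Fintype.bijective_iff_injective_and_card]
    refine ⟨fun x y hxy => hinj _ x y rfl ?_, by simp [hn]⟩
    simpa using (Fin.ext_iff.1 hxy).symm
  have step : ∀ x y, G.dist r x + 1 = G.dist r y → G.Adj x y := by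
    intro x y hxy
    obtain ⟨p, hpy, hp⟩ := exists_adj_dist_add_one_eq hG (r := r) (v := y)
      (by rintro rfl; simp at hxy)
    rwa [hinj _ x p rfl (by omega)]
  refine ⟨Equiv.ofBijective _ hb, fun v => rfl, fun x y => ⟨fun h => ?_, fun h => ?_⟩⟩
  · have h1 := dist_le_dist_add_one hG r h
    have h2 := dist_le_dist_add_one hG r h.symm
    have h3 : G.dist r x ≠ G.dist r y := fun he => h.ne (hinj _ x y rfl he.symm)
    simp only [Equiv.ofBijective_apply]
    omega
  · rcases h with h | h
    · exact step x y h
    · exact (step y x h).symm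

theorem nonempty_iso_pathGraph [Fintype V] (hG : G.Connected) (hB : ¬ Branching G) {r : V}
    (hr : ∀ x y, G.Adj r x → G.Adj r y → x = y) {n : ℕ} (hn : Fintype.card V = n) :
    Nonempty (G ≃g pathGraph n) := by
  obtain ⟨e, -, he⟩ := exists_equiv_fin_dist hG hB hr hn
  exact ⟨⟨e, by intro x y; rw [pathGraph_adj, he]⟩⟩

theorem exists_leaf_of_isTree [Fintype V] [Nontrivial V] (hG : G.IsTree) :
    ∃ r, ∀ x y, G.Adj r x → G.Adj r y → x = y := by
  classical
  obtain ⟨r, hr⟩ := hG.exists_vert_degree_one_of_nontrivial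
  rw [degree_eq_one_iff_existsUnique_adj] at hr
  exact ⟨r, fun x y hx hy => hr.unique hx hy⟩

/-! ### Maximisers of weighted distance sums -/

theorem exists_slide_weightedDist_lt [Fintype V] {w : V → V → ℝ} (hw : ∀ u v, 0 < w u v)
    (hG : G.IsTree) {u a b c : V} (ha : G.Adj u a) (hb : G.Adj u b) (hc : G.Adj u c)
    (hab : a ≠ b) (hac : a ≠ c) (hbc : b ≠ c) :
    ∃ (C : Set V) (h : IsCutEdge G C c u) (haC : a ∉ C) (hbC : b ∉ C),
      weightedDist w G < weightedDist w (slide G C c a h.left_mem haC) ∨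
      weightedDist w G < weightedDist w (slide G C c b h.left_mem hbC) := by
  obtain ⟨C, h⟩ := exists_isCutEdge_of_isTree hG hc.symm
  obtain ⟨S, hS⟩ := exists_isCutEdge_of_isTree hG ha.symm
  have haC : a ∉ C := fun hC => hac (h.unique _ _ ha.symm hC h.right_notMem).1
  have hbC : b ∉ C := fun hC => hbc (h.unique _ _ hb.symm hC h.right_notMem).1
  refine ⟨C, h, haC, hbC, ?_⟩
  by_contra! hcon
  have := two_mul_weightedDist_lt hw hG.connected h hS hb hab haC hbC
  linarith

theorem not_branching_of_isMax [Fintype V] {w : V → V → ℝ} (hw : ∀ u v, 0 < w u v)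
    (hG : G.Connected) (hmax : ∀ H : SimpleGraph V, H.Connected →
      weightedDist w H ≤ weightedDist w G) : G.IsTree ∧ ¬ Branching G := by
  have htree : G.IsTree := by
    obtain ⟨T, hle, hT⟩ := hG.exists_isTree_le
    by_cases hne : T = G
    · rwa [← hne]
    · exact absurd (weightedDist_lt_of_le hw hT.connected hle hne) (hmax T hT.connected).not_gt
  refine ⟨htree, ?_⟩
  rintro ⟨u, a, b, c, ha, hb, hc, hab, hac, hbc⟩
  obtain ⟨C, h, haC, hbC, hlt | hlt⟩ := exists_slide_weightedDist_lt hw htree ha hb hc hab hac hbc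
  · exact (hmax _ (slide_connected hG h haC)).not_gt hlt
  · exact (hmax _ (slide_connected hG h hbC)).not_gt hlt

/-- Among the connected graphs on `V`, only paths maximize a positively weighted sum of
distances. -/
theorem nonempty_iso_pathGraph_of_isMax [Fintype V] [Nontrivial V] {w : V → V → ℝ}
    (hw : ∀ u v, 0 < w u v)
    (hG : G.Connected) (hmax : ∀ H : SimpleGraph V, H.Connected →
      weightedDist w H ≤ weightedDist w G) {n : ℕ} (hn : Fintype.card V = n) :
    Nonempty (G ≃g pathGraph n) := by
  obtain ⟨hT, hB⟩ := not_branching_of_isMax hw hG hmax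
  obtain ⟨r, hr⟩ := exists_leaf_of_isTree hT
  exact nonempty_iso_pathGraph hG hB hr hn

/-- The slide raises the degree of `a` by one, lowers that of `u` by one and changes no other, so
degrees at most two afterwards translate back to `G`. -/
theorem degree_bounds_of_not_branching_slide {C : Set V} {c u a b : V} (h : IsCutEdge G C c u)
    (ha : a ∉ C) (hua : G.Adj u a) (hub : G.Adj u b) (hab : a ≠ b) (hac : a ≠ c) (hbc : b ≠ c)
    (hB : ¬ Branching (slide G C c a h.left_mem ha)) :
    (∀ z, G.Adj a z → z = u) ∧ (∀ z, G.Adj u z → z = a ∨ z = b ∨ z = c) ∧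
      ∀ s x y z, s ≠ u → G.Adj s x → G.Adj s y → G.Adj s z → x = y ∨ x = z ∨ y = z := by
  have hcu := h.adj.ne
  have hau := hua.ne
  have hca : (slide G C c a h.left_mem ha).Adj c a := Or.inr (Or.inl ⟨rfl, rfl⟩)
  have keep : ∀ {x y}, G.Adj x y → ¬ (x = c ∧ y = u) → ¬ (x = u ∧ y = c) →
    (slide G C c a h.left_mem ha).Adj x y := fun hxy h1 h2 => slide_adj_of_ne h hxy h1 h2
  rw [not_branching_iff] at hB
  refine ⟨fun z hz => ?_, fun z hz => ?_, fun s x y z hs hx hy hz => ?_⟩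
  · by_contra hzu
    have hzc : z ≠ c := by
      rintro rfl
      exact hau (h.unique _ _ hz.symm h.left_mem ha).2.symm
    have := hB a u z c (keep hua.symm (by tauto) (by tauto)) (keep hz (by tauto) (by tauto))
      hca.symm
    tauto
  · by_contra! hcon
    have := hB u a b z (keep hua (by tauto) (by tauto)) (keep hub (by tauto) (by tauto))
      (keep hz (by tauto) (by tauto))
    grind
  · by_cases hsc : s = c
    · subst hsc
      -- The vertex `c` trades its neighbour `u` for `a`.
      have two : ∀ y z, y ≠ u → z ≠ u → G.Adj s y → G.Adj s z → y = z := by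
        intro y z hyu hzu hy hz
        have mem : ∀ y, y ≠ u → G.Adj s y → a ≠ y := by
          rintro y hyu hy rfl
          exact hyu (h.unique _ _ hy h.left_mem ha).2
        have := hB s a y z hca (keep hy (by tauto) (by tauto)) (keep hz (by tauto) (by tauto))
        have := mem y hyu hy
        have := mem z hzu hz
        tauto
      by_cases hxu : x = u
      · by_cases hyu : y = u
        · exact Or.inl (hxu.trans hyu.symm)
        · by_cases hzu : z = u
          · exact Or.inr (Or.inl (hxu.trans hzu.symm))
          · exact Or.inr (Or.inr (two y z hyu hzu hy hz))
      · by_cases hyu : y = u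
        · by_cases hzu : z = u
          · exact Or.inr (Or.inr (hyu.trans hzu.symm))
          · exact Or.inr (Or.inl (two x z hxu hzu hx hz))
        · exact Or.inl (two x y hxu hyu hx hy)
    · exact hB s x y z (keep hx (by tauto) (by tauto)) (keep hy (by tauto) (by tauto))
        (keep hz (by tauto) (by tauto))

/-- Presents the broom as the path on `0, …, n - 1` with its last edge moved, ready for comparison
with a slid graph. -/
theorem broom_three_adj {n : ℕ} (hn : 4 ≤ n) (i j : Fin n) : (broom n 3).Adj i j ↔
    (((i : ℕ) + 1 = j ∨ (j : ℕ) + 1 = i) ∧ ¬ ((i : ℕ) + 1 = n ∧ (j : ℕ) + 2 = n) ∧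
      ¬ ((j : ℕ) + 1 = n ∧ (i : ℕ) + 2 = n)) ∨
    ((i : ℕ) + 1 = n ∧ (j : ℕ) + 3 = n) ∨ ((j : ℕ) + 1 = n ∧ (i : ℕ) + 3 = n) := by
  have hi := i.isLt
  have hj := j.isLt
  simp only [broom, fromRel_adj, ne_eq, Fin.ext_iff]
  omega

/-- A connected graph whose only branching vertex `u` has degree three, with two pendant neighbours,
is a broom. -/
theorem nonempty_iso_broom [Fintype V] (hG : G.Connected) {u a b c : V}
    (hua : G.Adj u a) (hub : G.Adj u b) (hab : a ≠ b)
    (hac : a ≠ c) (hbc : b ≠ c) (hu : ∀ z, G.Adj u z → z = a ∨ z = b ∨ z = c)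
    (hs : ∀ s x y z, s ≠ u → G.Adj s x → G.Adj s y → G.Adj s z → x = y ∨ x = z ∨ y = z)
    (ha : ∀ z, G.Adj a z → z = u) (hb : ∀ z, G.Adj b z → z = u) {n : ℕ} (hn4 : 4 ≤ n)
    (hn : Fintype.card V = n) : Nonempty (G ≃g broom n 3) := by
  have hau := hua.ne
  have hbu := hub.ne
  -- Hang the pendant vertex `b` on the pendant vertex `a`: the result is a path that starts `b, a,
  -- u`.
  have h : IsCutEdge G {b} b u :=
    ⟨rfl, hbu, hub.symm, fun x y hxy hx _ => by
      obtain rfl : x = b := hx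
      exact ⟨rfl, hb y hxy⟩⟩
  have haS : a ∉ ({b} : Set V) := hab
  have hadj : ∀ x y, (slide G {b} b a h.left_mem haS).Adj x y ↔
      (G.Adj x y ∧ (x = b ↔ y = b)) ∨ (x = b ∧ y = a) ∨ (x = a ∧ y = b) := fun x y => Iff.rfl
  set G' := slide G {b} b a h.left_mem haS
  have hconn : G'.Connected := slide_connected hG h haS
  have nb : ∀ z, G'.Adj b z → z = a := by
    intro z hz
    rcases (hadj _ _).1 hz with ⟨h1, h2⟩ | h1 | h1
    · exact absurd (h2.1 rfl).symm h1.ne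
    · exact h1.2
    · exact absurd h1.1.symm hab
  have na : ∀ z, G'.Adj a z → z = u ∨ z = b := by
    intro z hz
    rcases (hadj _ _).1 hz with ⟨h1, -⟩ | h1 | h1
    · exact Or.inl (ha z h1)
    · exact absurd h1.1 hab
    · exact Or.inr h1.2
  have nu : ∀ z, G'.Adj u z → z = a ∨ z = c := by
    intro z hz
    rcases (hadj _ _).1 hz with ⟨h1, h2⟩ | h1 | h1
    · rcases hu z h1 with h3 | h3 | h3
      · exact Or.inl h3
      · exact absurd (h2.2 h3) hbu
      · exact Or.inr h3
    · exact absurd h1.1 hbu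
    · exact absurd h1.1 hau
  have ns : ∀ s z, s ≠ a → s ≠ b → G'.Adj s z → G.Adj s z := by
    intro s z hsa hsb hz
    rcases (hadj _ _).1 hz with ⟨h1, -⟩ | h1 | h1
    · exact h1
    · exact absurd h1.1 hsb
    · exact absurd h1.1 hsa
  have two : ∀ {p q x y z : V}, (x = p ∨ x = q) → (y = p ∨ y = q) → (z = p ∨ z = q) →
      x = y ∨ x = z ∨ y = z := by
    rintro p q x y z (rfl | rfl) (rfl | rfl) (rfl | rfl) <;> simp
  have hleaf : ∀ x y, G'.Adj b x → G'.Adj b y → x = y := fun x y hx hy =>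
    (nb x hx).trans (nb y hy).symm
  have hB : ¬ Branching G' := by
    rw [not_branching_iff]
    intro s x y z hx hy hz
    by_cases hsb : s = b
    · subst hsb
      exact Or.inl (hleaf x y hx hy)
    by_cases hsa : s = a
    · subst hsa
      exact two (na x hx) (na y hy) (na z hz)
    by_cases hsu : s = u
    · subst hsu
      exact two (nu x hx) (nu y hy) (nu z hz)
    exact hs s x y z hsu (ns s x hsa hsb hx) (ns s y hsa hsb hy) (ns s z hsa hsb hz)
  obtain ⟨e, he, hee⟩ := exists_equiv_fin_dist hconn hB hleaf hn
  have heb : (e b : ℕ) = 0 := by rw [he]; simp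
  have hea : (e a : ℕ) = 1 := by
    rw [he, dist_eq_one_iff_adj, hadj]
    tauto
  have heu : (e u : ℕ) = 2 := by
    have h1 : G'.Adj a u := (hadj _ _).2 (Or.inl ⟨hua.symm, by tauto⟩)
    have h2 : (e u : ℕ) ≠ 0 := fun h0 => hbu (e.injective (Fin.ext (h0.trans heb.symm)))
    rw [hee] at h1
    omega
  have val : ∀ x y, (e x : ℕ) = e y ↔ x = y := fun x y => by
    rw [← Fin.ext_iff, e.injective.eq_iff]
  have key : ∀ x y, G.Adj x y ↔ (G'.Adj x y ∧ ¬ (x = b ∧ y = a) ∧ ¬ (x = a ∧ y = b)) ∨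
      (x = b ∧ y = u) ∨ (x = u ∧ y = b) := by
    intro x y
    constructor
    · intro h1
      by_cases hxb : x = b
      · subst hxb
        exact Or.inr (Or.inl ⟨rfl, hb y h1⟩)
      by_cases hyb : y = b
      · subst hyb
        exact Or.inr (Or.inr ⟨hb x h1.symm, rfl⟩)
      exact Or.inl ⟨(hadj _ _).2 (Or.inl ⟨h1, by tauto⟩), by tauto, by tauto⟩
    · rintro (⟨h1, h2, h3⟩ | ⟨rfl, rfl⟩ | ⟨rfl, rfl⟩)
      · rcases (hadj _ _).1 h1 with h4 | h4 | h4
        · exact h4.1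
        · exact absurd h4 h2
        · exact absurd h4 h3
      · exact hub.symm
      · exact hub
  -- Reversal is needed since `e` numbers `b, a, u` as `0, 1, 2`, while the broom has its pendant
  -- pair at the top indices.
  refine ⟨⟨e.trans Fin.revPerm, fun {x y} => ?_⟩⟩
  rw [key, hee, ← val x b, ← val x a, ← val x u, ← val y a, ← val y b, ← val y u, heb, hea, heu,
    broom_three_adj hn4]
  simp only [Equiv.trans_apply, Fin.revPerm_apply, Fin.val_rev]
  have hx := (e x).isLt
  have hy := (e y).isLt
  generalize (e x : ℕ) = i at hx ⊢
  generalize (e y : ℕ) = j at hy ⊢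
  have hconsec : (n - (i + 1) + 1 = n - (j + 1) ∨ n - (j + 1) + 1 = n - (i + 1)) ↔
      (i + 1 = j ∨ j + 1 = i) := by
    omega
  have hrev : ∀ k, k < n → (n - (k + 1) + 1 = n ↔ k = 0) ∧ (n - (k + 1) + 2 = n ↔ k = 1) ∧
      (n - (k + 1) + 3 = n ↔ k = 2) := by
    intro k _
    omega
  obtain ⟨hi0, hi1, hi2⟩ := hrev i hx
  obtain ⟨hj0, hj1, hj2⟩ := hrev j hy
  rw [hconsec, hi0, hi1, hi2, hj0, hj1, hj2, and_comm (a := j = 0) (b := i = 1),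
    and_comm (a := j = 0) (b := i = 2)]

/-- Among the connected graphs on `V` with a vertex of degree at least three, only brooms maximize
a positively weighted sum of distances. -/
theorem nonempty_iso_broom_of_isMax [Fintype V] {w : V → V → ℝ} (hw : ∀ u v, 0 < w u v)
    (hG : G.Connected) (hB : Branching G) (hmax : ∀ H : SimpleGraph V, H.Connected → Branching H →
      weightedDist w H ≤ weightedDist w G) {n : ℕ} (hn4 : 4 ≤ n) (hn : Fintype.card V = n) :
    Nonempty (G ≃g broom n 3) := by
  obtain ⟨u, a, b, c, ha, hb, hc, hab, hac, hbc⟩ := hB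
  have htree : G.IsTree := by
    obtain ⟨T, hle, hT, hTu⟩ := exists_isTree_le_adj hG u
    by_cases hne : T = G
    · rwa [← hne]
    · exact absurd (weightedDist_lt_of_le hw hT.connected hle hne) (hmax T hT.connected
        ⟨u, a, b, c, hTu a ha, hTu b hb, hTu c hc, hab, hac, hbc⟩).not_gt
  -- By maximality an improving slide cannot be branching. So among any two of the three neighbours
  -- one is pendant, hence at least two are pendant in all.
  have pair : ∀ a b c, G.Adj u a → G.Adj u b → G.Adj u c → a ≠ b → a ≠ c → b ≠ c →
      ((∀ z, G.Adj a z → z = u) ∨ (∀ z, G.Adj b z → z = u)) ∧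
      (∀ z, G.Adj u z → z = a ∨ z = b ∨ z = c) ∧
      ∀ s x y z, s ≠ u → G.Adj s x → G.Adj s y → G.Adj s z → x = y ∨ x = z ∨ y = z := by
    intro a b c ha hb hc hab hac hbc
    obtain ⟨C, h, haC, hbC, hlt | hlt⟩ :=
      exists_slide_weightedDist_lt hw htree ha hb hc hab hac hbc
    · obtain ⟨h1, h2, h3⟩ := degree_bounds_of_not_branching_slide h haC ha hb hab hac hbc
        fun hBr => (hmax _ (slide_connected hG h haC) hBr).not_gt hlt
      exact ⟨Or.inl h1, h2, h3⟩
    · obtain ⟨h1, h2, h3⟩ := degree_bounds_of_not_branching_slide h hbC hb ha hab.symm hbc hac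
        fun hBr => (hmax _ (slide_connected hG h hbC) hBr).not_gt hlt
      exact ⟨Or.inr h1, fun z hz => by have := h2 z hz; tauto, h3⟩
  obtain ⟨h1, h2, h3⟩ := pair a b c ha hb hc hab hac hbc
  obtain ⟨h4, -, -⟩ := pair a c b ha hc hb hac hab hbc.symm
  obtain ⟨h5, -, -⟩ := pair b c a hb hc ha hbc hab.symm hac.symm
  have h2' : ∀ z, G.Adj u z → z = a ∨ z = c ∨ z = b := fun z hz => by have := h2 z hz; tauto
  have h2'' : ∀ z, G.Adj u z → z = b ∨ z = c ∨ z = a := fun z hz => by have := h2 z hz; tauto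
  by_cases la : ∀ z, G.Adj a z → z = u
  · by_cases lb : ∀ z, G.Adj b z → z = u
    · exact nonempty_iso_broom hG ha hb hab hac hbc h2 h3 la lb hn4 hn
    · exact nonempty_iso_broom hG ha hc hac hab hbc.symm h2' h3 la (h5.resolve_left lb) hn4 hn
  · exact nonempty_iso_broom hG hb hc hbc hab.symm hac.symm h2'' h3 (h1.resolve_left la)
      (h4.resolve_left la) hn4 hn

theorem broom_three_branching {n : ℕ} (hn : 4 ≤ n) : Branching (broom n 3) := by
  refine ⟨⟨n - 3, by omega⟩, ⟨n - 4, by omega⟩, ⟨n - 2, by omega⟩, ⟨n - 1, by omega⟩,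
    ?_, ?_, ?_, ?_, ?_, ?_⟩ <;> simp only [broom_three_adj hn, ne_eq, Fin.mk.injEq] <;> omega

theorem pathGraph_not_branching (n : ℕ) : ¬ Branching (pathGraph n) := by
  rw [not_branching_iff]
  intro u a b c
  simp only [pathGraph_adj, Fin.ext_iff]
  omega

theorem broom_three_connected {n : ℕ} (hn : 4 ≤ n) : (broom n 3).Connected := by
  have h0 : 0 < n := by omega
  have key : ∀ k (hk : k < n), (broom n 3).Reachable ⟨0, h0⟩ ⟨k, hk⟩ := by
    intro k
    induction k using Nat.strong_induction_on with
    | _ k ih =>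
      intro hk
      by_cases hk0 : k = 0
      · subst hk0
        exact Reachable.refl _
      · by_cases hkn : k + 1 = n
        · refine (ih (k - 2) (by omega) (by omega)).trans (Adj.reachable ?_)
          rw [broom_three_adj hn]
          dsimp only
          omega
        · refine (ih (k - 1) (by omega) (by omega)).trans (Adj.reachable ?_)
          rw [broom_three_adj hn]
          dsimp only
          omega
  have : Nonempty (Fin n) := ⟨⟨0, h0⟩⟩
  exact ⟨fun x y => (key x x.2).symm.trans (key y y.2)⟩

end Graph

open SimpleGraph Matrix

/-! ### Perron vectors and comparison of spectral radii -/

section Spectral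

variable {V : Type*} {G H : SimpleGraph V} {α : ℝ}

theorem dist_iso {V' : Type*} {G' : SimpleGraph V'} (e : G ≃g G') (hG : G.Connected) (u v : V) :
    G'.dist (e u) (e v) = G.dist u v := by
  have hG' : G'.Connected := e.connected_iff.1 hG
  apply le_antisymm
  · simpa using le_add_dist_of_adj hG (fun z => G'.dist (e u) (e z))
      (fun x y h => dist_le_dist_add_one hG' _ (e.map_adj_iff.2 h)) u v
  · simpa using le_add_dist_of_adj hG' (fun z => G.dist u (e.symm z))
      (fun x y h => dist_le_dist_add_one hG _ (e.symm.map_adj_iff.2 h)) (e u) (e v)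

/-- The weights for which the quadratic form of `D_α(G)` is a weighted sum of distances. -/
noncomputable def formWeight (α : ℝ) (x : V → ℝ) (u v : V) : ℝ :=
  α * ((x u ^ 2 + x v ^ 2) / 2) + (1 - α) * (x u * x v)

theorem formWeight_pos (hα0 : 0 ≤ α) (hα1 : α < 1) {x : V → ℝ} (hx : ∀ v, 0 < x v) (u v : V) :
    0 < formWeight α x u v := by
  have hu := hx u
  have hv := hx v
  have : 0 < 1 - α := by linarith
  unfold formWeight
  positivity

variable [Fintype V] [DecidableEq V]

theorem distAlphaMatrix_mulVec (x : V → ℝ) (u : V) : (distAlphaMatrix α G *ᵥ x) u =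
    ∑ v, (G.dist u v : ℝ) * (α * x u + (1 - α) * x v) := by
  rw [distAlphaMatrix, add_mulVec, smul_mulVec, smul_mulVec, Pi.add_apply, Pi.smul_apply,
    Pi.smul_apply, mulVec_diagonal]
  simp only [smul_eq_mul, transmission, mulVec, dotProduct, distMatrix, of_apply, Finset.mul_sum,
    Finset.sum_mul, ← Finset.sum_add_distrib]
  exact Finset.sum_congr rfl fun v _ => by ring

theorem dotProduct_distAlphaMatrix_mulVec (x : V → ℝ) :
    x ⬝ᵥ (distAlphaMatrix α G *ᵥ x) = weightedDist (formWeight α x) G := by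
  have h1 : x ⬝ᵥ (distAlphaMatrix α G *ᵥ x) =
      ∑ u, ∑ v, (G.dist u v : ℝ) * (α * x u ^ 2 + (1 - α) * (x u * x v)) := by
    simp only [dotProduct, distAlphaMatrix_mulVec, Finset.mul_sum]
    exact Finset.sum_congr rfl fun u _ => Finset.sum_congr rfl fun v _ => by ring
  have h2 : x ⬝ᵥ (distAlphaMatrix α G *ᵥ x) =
      ∑ u, ∑ v, (G.dist u v : ℝ) * (α * x v ^ 2 + (1 - α) * (x u * x v)) := by
    rw [h1, Finset.sum_comm]
    exact Finset.sum_congr rfl fun u _ => Finset.sum_congr rfl fun v _ => by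
      rw [G.dist_comm]
      ring
  -- Averaging the expressions with `x u ^ 2` and with `x v ^ 2` produces the symmetric weight.
  have h3 : weightedDist (formWeight α x) G =
      (x ⬝ᵥ (distAlphaMatrix α G *ᵥ x) + x ⬝ᵥ (distAlphaMatrix α G *ᵥ x)) / 2 := by
    nth_rewrite 1 [h1]
    rw [h2]
    simp only [weightedDist, formWeight, ← Finset.sum_add_distrib, Finset.sum_div]
    exact Finset.sum_congr rfl fun u _ => Finset.sum_congr rfl fun v _ => by ring
  rw [h3]
  ring

/-- Semidefiniteness gives both the Rayleigh bound and, through its kernel, the fact that a vector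
attaining the bound is an eigenvector. -/
theorem posSemidef_smul_one_sub {A : Matrix V V ℝ} (hA : A.IsHermitian) {μ : ℝ}
    (hμ : ∀ i, hA.eigenvalues i ≤ μ) : (μ • (1 : Matrix V V ℝ) - A).PosSemidef := by
  have h : μ • (1 : Matrix V V ℝ) - A = (hA.eigenvectorUnitary : Matrix V V ℝ) *
      diagonal (fun i => μ - hA.eigenvalues i) *
      ((hA.eigenvectorUnitary : Matrix V V ℝ))ᴴ := by
    have h1 := hA.spectral_theorem
    rw [Unitary.conjStarAlgAut_apply] at h1
    have h2 : (diagonal (fun i => μ - hA.eigenvalues i) : Matrix V V ℝ) =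
        μ • 1 - diagonal (RCLike.ofReal ∘ hA.eigenvalues) := by
      ext i j
      by_cases hij : i = j
      · subst hij; simp
      · simp [hij]
    have h3 : (hA.eigenvectorUnitary : Matrix V V ℝ) * (hA.eigenvectorUnitary : Matrix V V ℝ)ᴴ = 1 :=
      Unitary.coe_mul_star_self hA.eigenvectorUnitary
    rw [h2, mul_sub, sub_mul, Matrix.mul_smul, mul_one, Matrix.smul_mul, h3]
    exact congrArg _ h1
  rw [h]
  exact (PosSemidef.diagonal fun i => sub_nonneg.2 (hμ i)).mul_mul_conjTranspose_same _

theorem posSemidef_spectralRadius_sub :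
    (spectralRadius α G • (1 : Matrix V V ℝ) - distAlphaMatrix α G).PosSemidef :=
  posSemidef_smul_one_sub (distAlphaMatrix_isHermitian α G) fun i =>
    le_ciSup (Set.finite_range _).bddAbove i

theorem dotProduct_mulVec_spectralRadius_sub (x : V → ℝ) :
    x ⬝ᵥ ((spectralRadius α G • (1 : Matrix V V ℝ) - distAlphaMatrix α G) *ᵥ x) =
      spectralRadius α G * (x ⬝ᵥ x) - weightedDist (formWeight α x) G := by
  rw [sub_mulVec, dotProduct_sub, smul_mulVec, one_mulVec, dotProduct_smul, smul_eq_mul,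
    dotProduct_distAlphaMatrix_mulVec]

theorem weightedDist_le_spectralRadius_mul (x : V → ℝ) :
    weightedDist (formWeight α x) G ≤ spectralRadius α G * (x ⬝ᵥ x) := by
  have h := (posSemidef_spectralRadius_sub (α := α) (G := G)).dotProduct_mulVec_nonneg x
  rw [star_trivial, dotProduct_mulVec_spectralRadius_sub] at h
  linarith

theorem exists_eigenvector_spectralRadius [Nonempty V] : ∃ x : V → ℝ, x ≠ 0 ∧
    distAlphaMatrix α G *ᵥ x = spectralRadius α G • x := by
  have hA := distAlphaMatrix_isHermitian α G
  obtain ⟨i, hi⟩ := exists_eq_ciSup_of_finite (f := hA.eigenvalues)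
  refine ⟨hA.eigenvectorBasis i, ?_, ?_⟩
  · intro h0
    have h1 := hA.eigenvectorBasis.orthonormal.ne_zero i
    exact h1 (by ext j; exact congrFun h0 j)
  · rw [hA.mulVec_eigenvectorBasis i, hi]
    rfl

/-- A connected graph has a positive vector attaining the spectral radius. -/
theorem exists_pos_eigenvector [Nontrivial V] (hα1 : α < 1) (hG : G.Connected) :
    ∃ x : V → ℝ, (∀ v, 0 < x v) ∧ 0 < x ⬝ᵥ x ∧
      weightedDist (formWeight α x) G = spectralRadius α G * (x ⬝ᵥ x) := by
  obtain ⟨x, hx0, hx⟩ := exists_eigenvector_spectralRadius (α := α) (G := G)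
  -- Absolute values keep the squares and do not decrease the products, so `y` attains the Rayleigh
  -- bound as well.
  set y : V → ℝ := fun v => |x v| with hy
  have hyy : y ⬝ᵥ y = x ⬝ᵥ x := by simp [dotProduct, hy]
  have hle : weightedDist (formWeight α x) G ≤ weightedDist (formWeight α y) G := by
    refine Finset.sum_le_sum fun u _ => Finset.sum_le_sum fun v _ =>
      mul_le_mul_of_nonneg_right ?_ (Nat.cast_nonneg _)
    simp only [formWeight, hy, sq_abs, ← abs_mul]
    have := mul_le_mul_of_nonneg_left (le_abs_self (x u * x v)) (sub_nonneg.2 hα1.le)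
    linarith
  have hxq : weightedDist (formWeight α x) G = spectralRadius α G * (x ⬝ᵥ x) := by
    rw [← dotProduct_distAlphaMatrix_mulVec, hx, dotProduct_smul, smul_eq_mul]
  have hyq : weightedDist (formWeight α y) G = spectralRadius α G * (y ⬝ᵥ y) :=
    le_antisymm (weightedDist_le_spectralRadius_mul y) (by rw [hyy, ← hxq]; exact hle)
  have hker : (spectralRadius α G • (1 : Matrix V V ℝ) - distAlphaMatrix α G) *ᵥ y = 0 := by
    rw [← posSemidef_spectralRadius_sub.dotProduct_mulVec_zero_iff, star_trivial,
      dotProduct_mulVec_spectralRadius_sub, hyq, sub_self]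
  have heig : ∀ u, ∑ v, (G.dist u v : ℝ) * (α * y u + (1 - α) * y v) =
      spectralRadius α G * y u := fun u => by
    have := congrFun hker u
    rw [sub_mulVec, smul_mulVec, one_mulVec, Pi.sub_apply, distAlphaMatrix_mulVec] at this
    simp only [Pi.smul_apply, smul_eq_mul, Pi.zero_apply] at this
    linarith
  have hy0 : ∀ v, 0 ≤ y v := fun v => abs_nonneg _
  obtain ⟨t, ht⟩ : ∃ t, 0 < y t := by
    obtain ⟨t, ht⟩ := Function.ne_iff.1 hx0
    exact ⟨t, abs_pos.2 ht⟩
  -- At a zero of `y` the eigenvalue equation is a vanishing sum of nonnegative terms, yet the term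
  -- at `t` is positive.
  have hpos : ∀ v, 0 < y v := fun v => by
    refine lt_of_le_of_ne (hy0 v) fun h0 => ?_
    have hvt : v ≠ t := fun h => by rw [h] at h0; exact ht.ne h0
    have h1 := heig v
    rw [← h0, mul_zero, mul_zero, Finset.sum_eq_zero_iff_of_nonneg] at h1
    · have h2 := h1 t (Finset.mem_univ _)
      have h3 : (0 : ℝ) < G.dist v t := by exact_mod_cast hG.pos_dist_of_ne hvt
      have h4 : 0 < 1 - α := by linarith
      have : 0 < (G.dist v t : ℝ) * (0 + (1 - α) * y t) := by positivity
      exact this.ne' h2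
    · intro s _
      have h4 : 0 ≤ 1 - α := by linarith
      have := hy0 s
      positivity
  refine ⟨y, hpos, ?_, hyq⟩
  exact Finset.sum_pos (fun v _ => mul_pos (hpos v) (hpos v)) ⟨t, Finset.mem_univ _⟩

theorem spectralRadius_lt_of_weightedDist_lt {x : V → ℝ} (hx : 0 < x ⬝ᵥ x)
    (hG : weightedDist (formWeight α x) G = spectralRadius α G * (x ⬝ᵥ x))
    (hlt : weightedDist (formWeight α x) G < weightedDist (formWeight α x) H) :
    spectralRadius α G < spectralRadius α H := by
  rw [hG] at hlt
  exact lt_of_mul_lt_mul_right (hlt.trans_le (weightedDist_le_spectralRadius_mul x)) hx.le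

theorem spectralRadius_le_of_iso {V' : Type*} [Fintype V'] [DecidableEq V'] [Nontrivial V]
    {G' : SimpleGraph V'} (hα1 : α < 1) (hG : G.Connected) (e : G ≃g G') :
    spectralRadius α G ≤ spectralRadius α G' := by
  obtain ⟨x, -, hx, hq⟩ := exists_pos_eigenvector hα1 hG
  set y : V' → ℝ := fun v => x (e.symm v) with hy
  have h1 : y ⬝ᵥ y = x ⬝ᵥ x := by
    simp only [dotProduct]
    exact (Fintype.sum_equiv e.toEquiv _ _ fun v => by simp [hy]).symm
  have h2 : weightedDist (formWeight α y) G' = weightedDist (formWeight α x) G := by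
    simp only [weightedDist]
    refine (Fintype.sum_equiv e.toEquiv _ _ fun u => Fintype.sum_equiv e.toEquiv _ _ fun v => ?_).symm
    have := dist_iso e hG u v
    simp [hy, formWeight, this]
  have h3 := weightedDist_le_spectralRadius_mul (G := G') (α := α) y
  rw [h1, h2, hq] at h3
  exact le_of_mul_le_mul_right h3 hx

theorem spectralRadius_eq_of_iso {V' : Type*} [Fintype V'] [DecidableEq V'] [Nontrivial V]
    {G' : SimpleGraph V'} (hα1 : α < 1) (hG : G.Connected) (e : G ≃g G') :
    spectralRadius α G = spectralRadius α G' :=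
  have : Nontrivial V' := e.toEquiv.symm.nontrivial
  le_antisymm (spectralRadius_le_of_iso hα1 hG e)
    (spectralRadius_le_of_iso hα1 (e.connected_iff.1 hG) e.symm)

/-- With the weights of a Perron vector of `G`, some maximiser `M` is a path; `G`, not being a path,
is no maximiser, so its sum is strictly smaller. -/
theorem spectralRadius_lt_pathGraph [Nontrivial V] (hα0 : 0 ≤ α) (hα1 : α < 1) (hG : G.Connected)
    {n : ℕ} (hn : Fintype.card V = n) (hne : ¬ Nonempty (G ≃g pathGraph n)) :
    spectralRadius α G < spectralRadius α (pathGraph n) := by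
  obtain ⟨x, hx, hxx, hq⟩ := exists_pos_eigenvector hα1 hG
  obtain ⟨M, hM, hmax⟩ := Set.exists_max_image {H : SimpleGraph V | H.Connected}
    (weightedDist (formWeight α x)) (Set.toFinite _) ⟨G, hG⟩
  have hw := formWeight_pos hα0 hα1 hx
  obtain ⟨e⟩ := nonempty_iso_pathGraph_of_isMax hw hM hmax hn
  rw [← spectralRadius_eq_of_iso hα1 hM e]
  refine spectralRadius_lt_of_weightedDist_lt hxx hq (lt_of_not_ge fun hle => hne ?_)
  exact nonempty_iso_pathGraph_of_isMax hw hG (fun H hH => (hmax H hH).trans hle) hn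

theorem spectralRadius_lt_broom_of_branching [Nontrivial V] (hα0 : 0 ≤ α) (hα1 : α < 1)
    (hG : G.Connected) (hB : Branching G) {n : ℕ} (hn4 : 4 ≤ n) (hn : Fintype.card V = n)
    (hne : ¬ Nonempty (G ≃g broom n 3)) :
    spectralRadius α G < spectralRadius α (broom n 3) := by
  obtain ⟨x, hx, hxx, hq⟩ := exists_pos_eigenvector hα1 hG
  obtain ⟨M, hM, hmax⟩ := Set.exists_max_image {H : SimpleGraph V | H.Connected ∧ Branching H}
    (weightedDist (formWeight α x)) (Set.toFinite _) ⟨G, hG, hB⟩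
  have hw := formWeight_pos hα0 hα1 hx
  obtain ⟨e⟩ := nonempty_iso_broom_of_isMax hw hM.1 hM.2 (fun H h1 h2 => hmax H ⟨h1, h2⟩) hn4 hn
  rw [← spectralRadius_eq_of_iso hα1 hM.1 e]
  refine spectralRadius_lt_of_weightedDist_lt hxx hq (lt_of_not_ge fun hle => hne ?_)
  exact nonempty_iso_broom_of_isMax hw hG hB (fun H h1 h2 => (hmax H ⟨h1, h2⟩).trans hle) hn4 hn

end Spectral

open SimpleGraph Matrix

/-! ### Cycles have smaller radius than the broom -/

section Cycle

/-- The sum is the transmission of a cycle. From `n` to `n + 2` it grows by `n + 1`. -/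
theorem four_mul_sum_range_min_le (n : ℕ) : 4 * ∑ k ∈ Finset.range n, min k (n - k) ≤ n ^ 2 := by
  induction n using Nat.twoStepInduction with
  | zero => simp
  | one => simp
  | more n ih _ =>
    have h : ∑ k ∈ Finset.range (n + 2), min k (n + 2 - k) =
        ∑ k ∈ Finset.range n, min k (n - k) + (n + 1) := by
      rw [Finset.sum_range_succ, Finset.sum_range_succ']
      have h1 : ∀ k ∈ Finset.range n, min (k + 1) (n + 2 - (k + 1)) = min k (n - k) + 1 := by
        intro k hk
        rw [Finset.mem_range] at hk
        omega
      rw [Finset.sum_congr rfl h1, Finset.sum_add_distrib, Finset.sum_const, Finset.card_range]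
      simp only [smul_eq_mul]
      omega
    rw [h]
    nlinarith

theorem four_mul_sum_range_cyclic_le {n i : ℕ} (hi : i ≤ n) (f : ℕ → ℕ)
    (h1 : ∀ j < i, f j ≤ i - j ∧ f j ≤ n - (i - j))
    (h2 : ∀ k < n - i, f (i + k) ≤ k ∧ f (i + k) ≤ n - k) :
    4 * ∑ j ∈ Finset.range n, f j ≤ n ^ 2 := by
  refine le_trans (Nat.mul_le_mul_left 4 ?_) (four_mul_sum_range_min_le n)
  obtain ⟨l, rfl⟩ := Nat.exists_eq_add_of_le hi
  rw [Finset.sum_range_add]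
  -- Rotate the cycle so that position `i` becomes `0`: `i + k` moves to `k`, and `j < i` moves to
  -- `l + j`.
  conv_rhs => rw [show Finset.range (i + l) = Finset.range (l + i) by rw [Nat.add_comm]]
  rw [Finset.sum_range_add, Nat.add_comm (∑ x ∈ Finset.range i, f x)]
  refine add_le_add (Finset.sum_le_sum fun k hk => ?_) (Finset.sum_le_sum fun j hj => ?_)
  · rw [Finset.mem_range] at hk
    have := h2 k (by omega)
    omega
  · rw [Finset.mem_range] at hj
    have := h1 j hj
    omega

variable {V : Type*} [Fintype V] {G : SimpleGraph V} {α : ℝ}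

/-- A connected graph with all degrees at most two, other than a path, has transmissions at most
`n ^ 2 / 4`. -/
theorem four_mul_sum_dist_le [Nontrivial V] (hG : G.Connected) (hB : ¬ Branching G) {n : ℕ}
    (hn : Fintype.card V = n) (hne : ¬ Nonempty (G ≃g pathGraph n)) (x : V) :
    4 * ∑ y, G.dist x y ≤ n ^ 2 := by
  -- A spanning tree is a path with end `r`. As `G` is not a path, `r` has a further neighbour `s`,
  -- which must be the other end, since an inner vertex would acquire a third neighbour.
  obtain ⟨T, hle, hT⟩ := hG.exists_isTree_le
  obtain ⟨r, hr⟩ := exists_leaf_of_isTree hT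
  have hTB : ¬ Branching T := fun ⟨u, a, b, c, ha, hb, hc, h⟩ =>
    hB ⟨u, a, b, c, hle ha, hle hb, hle hc, h⟩
  obtain ⟨e, he, hee⟩ := exists_equiv_fin_dist hT.connected hTB hr hn
  have her : (e r : ℕ) = 0 := by rw [he]; simp
  obtain ⟨s, hrs, hnrs⟩ : ∃ s, G.Adj r s ∧ ¬ T.Adj r s := by
    by_contra! hcon
    exact hne (nonempty_iso_pathGraph hG hB
      (fun x y hx hy => hr x y (hcon x hx) (hcon y hy)) hn)
  have hes : (e s : ℕ) + 1 = n := by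
    by_contra hcon
    have hlt : (e s : ℕ) + 1 < n := by have := (e s).isLt; omega
    obtain ⟨p, hps, hp⟩ := exists_adj_dist_add_one_eq hT.connected hrs.ne'
    rw [← he, ← he] at hp
    have hpr : p ≠ r := by rintro rfl; exact hnrs hps
    have hq : T.Adj s (e.symm ⟨e s + 1, hlt⟩) := by rw [hee]; simp
    rw [not_branching_iff] at hB
    rcases hB s r p _ hrs.symm (hle hps.symm) (hle hq) with h | h | h
    · exact hpr h.symm
    · rw [h] at her
      simp at her
    · rw [h, Equiv.apply_symm_apply] at hp
      dsimp only at hp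
      omega
  have hd : ∀ k x y, (e x : ℕ) + k = e y → G.dist x y ≤ k := by
    intro k
    induction k with
    | zero =>
      intro x y h
      rw [e.injective (Fin.ext h : e x = e y)]
      simp
    | succ k ih =>
      intro x y h
      have hlt : (e x : ℕ) + k < n := by have := (e y).isLt; omega
      have h1 := ih x (e.symm ⟨e x + k, hlt⟩) (by simp)
      have h2 := dist_le_dist_add_one hG x (x := e.symm ⟨e x + k, hlt⟩) (y := y)
        (hle (by rw [hee]; simp; omega))
      omega
  -- The other way round the cycle, through the closing edge `rs`.
  have hd' : ∀ x y, (e x : ℕ) ≤ e y → G.dist x y ≤ n - (e y - e x) := by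
    intro x y h
    have h1 := hd (e x) r x (by omega)
    have h2 := hd (n - 1 - e y) y s (by have := (e y).isLt; omega)
    have h3 := hG.dist_triangle (u := x) (v := r) (w := y)
    have h4 := hG.dist_triangle (u := r) (v := s) (w := y)
    rw [dist_eq_one_iff_adj.2 hrs] at h4
    rw [G.dist_comm] at h1 h2
    have := (e y).isLt
    omega
  have hx := (e x).isLt
  set f : ℕ → ℕ := fun j => if h : j < n then G.dist x (e.symm ⟨j, h⟩) else 0 with hf
  have hsum : ∑ y, G.dist x y = ∑ j ∈ Finset.range n, f j := by
    rw [← Fin.sum_univ_eq_sum_range]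
    exact Fintype.sum_equiv e _ _ fun y => by simp [hf]
  rw [hsum]
  refine four_mul_sum_range_cyclic_le (i := e x) hx.le f (fun j hj => ?_) (fun k hk => ?_)
  · have hjn : j < n := hj.trans hx
    simp only [hf, hjn, dif_pos]
    rw [G.dist_comm]
    have h1 := hd (e x - j) (e.symm ⟨j, hjn⟩) x (by simp; omega)
    have h2 := hd' (e.symm ⟨j, hjn⟩) x (by simp; omega)
    simp only [Equiv.apply_symm_apply] at h2
    exact ⟨h1, h2⟩
  · have hjn : (e x : ℕ) + k < n := by omega
    simp only [hf, hjn, dif_pos]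
    have h1 := hd k x (e.symm ⟨e x + k, hjn⟩) (by simp)
    have h2 := hd' x (e.symm ⟨e x + k, hjn⟩) (by simp)
    simp only [Equiv.apply_symm_apply, Nat.add_sub_cancel_left] at h2
    exact ⟨h1, h2⟩

variable [DecidableEq V]

/-- Since `x u * x v ≤ (x u ^ 2 + x v ^ 2) / 2`, the form is at most the sum of `x u ^ 2 *
transmission G u`. -/
theorem spectralRadius_le_of_transmission_le [Nontrivial V] (hα1 : α < 1)
    (hG : G.Connected) {t : ℝ} (ht : ∀ u, transmission G u ≤ t) : spectralRadius α G ≤ t := by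
  obtain ⟨x, -, hxx, hq⟩ := exists_pos_eigenvector (α := α) hα1 hG
  have h1 : weightedDist (formWeight α x) G ≤
      ∑ u, ∑ v, ((x u ^ 2 * G.dist u v) / 2 + (x v ^ 2 * G.dist u v) / 2) := by
    refine Finset.sum_le_sum fun u _ => Finset.sum_le_sum fun v _ => ?_
    have h2 : x u * x v ≤ (x u ^ 2 + x v ^ 2) / 2 := by nlinarith [sq_nonneg (x u - x v)]
    have h3 := mul_le_mul_of_nonneg_left h2 (sub_nonneg.2 hα1.le)
    have h4 : formWeight α x u v ≤ (x u ^ 2 + x v ^ 2) / 2 := by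
      unfold formWeight
      linarith
    have := mul_le_mul_of_nonneg_right h4 (Nat.cast_nonneg (α := ℝ) (G.dist u v))
    linarith
  have h2 : ∑ u, ∑ v, ((x u ^ 2 * G.dist u v) / 2 + (x v ^ 2 * G.dist u v) / 2) =
      ∑ u, x u ^ 2 * transmission G u := by
    simp only [Finset.sum_add_distrib]
    rw [Finset.sum_comm (f := fun u v => (x v ^ 2 * (G.dist u v : ℝ)) / 2),
      ← Finset.sum_add_distrib]
    refine Finset.sum_congr rfl fun u _ => ?_
    rw [← Finset.sum_add_distrib, transmission, Finset.mul_sum]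
    refine Finset.sum_congr rfl fun v _ => ?_
    rw [G.dist_comm (u := v)]
    ring
  have h3 : ∑ u, x u ^ 2 * transmission G u ≤ t * (x ⬝ᵥ x) := by
    rw [dotProduct, Finset.mul_sum]
    refine Finset.sum_le_sum fun u _ => ?_
    have := mul_le_mul_of_nonneg_left (ht u) (sq_nonneg (x u))
    linarith
  rw [h2, hq] at h1
  exact le_of_mul_le_mul_right (h1.trans h3) hxx

/-- Rayleigh bound at the all-ones vector, whose weights equal `1` for every `α`. -/
theorem sum_sum_dist_le_card_mul_spectralRadius :
    ∑ u, ∑ v, (G.dist u v : ℝ) ≤ Fintype.card V * spectralRadius α G := by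
  have h := weightedDist_le_spectralRadius_mul (G := G) (α := α) (fun _ => 1)
  have h1 : ∀ u v, formWeight α (fun _ : V => (1 : ℝ)) u v = 1 := fun u v => by
    unfold formWeight
    ring
  simp only [weightedDist, h1, one_mul, dotProduct, mul_one, Finset.sum_const, Finset.card_univ,
    nsmul_eq_mul] at h
  linarith

theorem sum_range_sub (a : ℝ) (k : ℕ) :
    ∑ i ∈ Finset.range k, (a - i) = k * a - k * (k - 1) / 2 := by
  induction k with
  | zero => simp
  | succ k ih =>
    rw [Finset.sum_range_succ, ih]
    push_cast
    ring

theorem sum_sum_abs_sub (m : ℕ) :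
    ∑ i : Fin (m + 1), ∑ j : Fin (m + 1), |(i : ℝ) - j| = m * (m + 1) * (m + 2) / 3 := by
  induction m with
  | zero => simp
  | succ m ih =>
    rw [Fin.sum_univ_castSucc]
    simp only [Fin.sum_univ_castSucc (n := m + 1), Finset.sum_add_distrib, Fin.val_castSucc,
      Fin.val_last, sub_self, abs_zero, add_zero]
    rw [ih]
    have h : ∀ i : Fin (m + 1), |((m + 1 : ℕ) : ℝ) - (i : ℕ)| = ((m + 1 : ℕ) : ℝ) - (i : ℕ) :=
      fun i => abs_of_nonneg (sub_nonneg.2 (by exact_mod_cast i.isLt.le))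
    simp only [abs_sub_comm _ ((m + 1 : ℕ) : ℝ), h]
    rw [Fin.sum_univ_eq_sum_range (fun i => ((m + 1 : ℕ) : ℝ) - (i : ℕ)), sum_range_sub]
    push_cast
    ring

/-- Folding the pendant twins `m` and `m + 1` together maps the broom onto a path without
lengthening edges. -/
theorem abs_min_sub_min_le_broom_dist {m : ℕ} (hm : 2 ≤ m) (p q : Fin (m + 2)) :
    |((min (p : ℕ) m : ℕ) : ℝ) - (min (q : ℕ) m : ℕ)| ≤ (broom (m + 2) 3).dist p q := by
  have hc : (broom (m + 2) 3).Connected := broom_three_connected (by omega)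
  have h : ∀ p q : Fin (m + 2), min (q : ℕ) m ≤ min (p : ℕ) m + (broom (m + 2) 3).dist p q := by
    refine le_add_dist_of_adj hc (fun z => min (z : ℕ) m) fun x y hxy => ?_
    rw [broom_three_adj (by omega)] at hxy
    omega
  have h1 := h p q
  have h2 := h q p
  rw [SimpleGraph.dist_comm] at h2
  rw [abs_le]
  constructor
  · have : ((min (q : ℕ) m : ℕ) : ℝ) ≤ (min (p : ℕ) m : ℕ) + (broom (m + 2) 3).dist p q := by
      exact_mod_cast h1
    linarith
  · have : ((min (p : ℕ) m : ℕ) : ℝ) ≤ (min (q : ℕ) m : ℕ) + (broom (m + 2) 3).dist p q := by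
      exact_mod_cast h2
    linarith

/-- The first term counts the path `0, …, m`. The rest is twice `m * (m + 1) / 2 + 2`, from the last
vertex, whose twin is at distance `2`. -/
theorem le_sum_sum_broom_dist {m : ℕ} (hm : 2 ≤ m) :
    (m * (m + 1) * (m + 2) / 3 + m * (m + 1) + 4 : ℝ) ≤
      ∑ u, ∑ v, ((broom (m + 2) 3).dist u v : ℝ) := by
  set B := broom (m + 2) 3 with hBdef
  have hc : B.Connected := broom_three_connected (by omega)
  have hmain : (m * (m + 1) * (m + 2) / 3 : ℝ) ≤
      ∑ i : Fin (m + 1), ∑ j : Fin (m + 1), (B.dist i.castSucc j.castSucc : ℝ) := by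
    rw [← sum_sum_abs_sub]
    refine Finset.sum_le_sum fun i _ => Finset.sum_le_sum fun j _ => ?_
    have h := abs_min_sub_min_le_broom_dist hm i.castSucc j.castSucc
    rwa [Fin.val_castSucc, Fin.val_castSucc, min_eq_left (by omega), min_eq_left (by omega)] at h
  have hlast : (m * (m + 1) / 2 + 2 : ℝ) ≤
      ∑ j : Fin (m + 1), (B.dist (Fin.last (m + 1)) j.castSucc : ℝ) := by
    rw [Fin.sum_univ_castSucc]
    have h1 : ∀ j : Fin m, (m : ℝ) - (j : ℕ) ≤ B.dist (Fin.last (m + 1)) j.castSucc.castSucc := by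
      intro j
      have h := abs_min_sub_min_le_broom_dist hm (Fin.last (m + 1)) j.castSucc.castSucc
      rw [Fin.val_castSucc, Fin.val_castSucc, Fin.val_last, min_eq_right (by omega),
        min_eq_left (by omega)] at h
      exact (le_abs_self _).trans h
    have h2 : (2 : ℝ) ≤ B.dist (Fin.last (m + 1)) (Fin.last m).castSucc := by
      have := hc.one_lt_dist_of_ne_of_not_adj (u := Fin.last (m + 1)) (v := (Fin.last m).castSucc)
        (by simp [Fin.ext_iff]) (by
          rw [hBdef, broom_three_adj (by omega)]
          simp [Fin.val_last])
      exact_mod_cast this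
    have h3 : (m * (m + 1) / 2 : ℝ) = ∑ j : Fin m, ((m : ℝ) - (j : ℕ)) := by
      rw [Fin.sum_univ_eq_sum_range (fun i => (m : ℝ) - (i : ℕ)), sum_range_sub]
      ring
    rw [h3]
    exact add_le_add (Finset.sum_le_sum fun j _ => h1 j) h2
  rw [Fin.sum_univ_castSucc]
  simp only [Fin.sum_univ_castSucc (n := m + 1), Finset.sum_add_distrib, SimpleGraph.dist_self,
    Nat.cast_zero, add_zero]
  simp only [B.dist_comm (v := Fin.last (m + 1))]
  linarith

theorem spectralRadius_lt_broom_of_not_branching (hα1 : α < 1) (hG : G.Connected)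
    (hB : ¬ Branching G) {n : ℕ} (hn4 : 4 ≤ n) (hn : Fintype.card V = n)
    (hne : ¬ Nonempty (G ≃g pathGraph n)) :
    spectralRadius α G < spectralRadius α (broom n 3) := by
  have : Nontrivial V := Fintype.one_lt_card_iff_nontrivial.1 (by omega)
  have h1 : spectralRadius α G ≤ (n : ℝ) ^ 2 / 4 := by
    refine spectralRadius_le_of_transmission_le hα1 hG fun u => ?_
    have : (4 * ∑ v, G.dist u v : ℝ) ≤ (n : ℝ) ^ 2 := by
      exact_mod_cast four_mul_sum_dist_le hG hB hn hne u
    unfold transmission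
    push_cast at this
    linarith
  obtain ⟨m, rfl⟩ : ∃ m, n = m + 2 := ⟨n - 2, by omega⟩
  have h2 := (le_sum_sum_broom_dist (m := m) (by omega)).trans
    (sum_sum_dist_le_card_mul_spectralRadius (α := α))
  rw [Fintype.card_fin] at h2
  refine h1.trans_lt (lt_of_mul_lt_mul_left (lt_of_lt_of_le ?_ h2) (Nat.cast_nonneg (m + 2)))
  have hm : (2 : ℝ) ≤ m := by exact_mod_cast (by omega : 2 ≤ m)
  push_cast
  -- With `s = m - 2`, twelve times the gap is `s ^ 3 + 12 * s ^ 2 + 20 * s + 24`.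
  nlinarith [mul_nonneg (sub_nonneg.2 hm) (sub_nonneg.2 hm),
    mul_nonneg (mul_nonneg (sub_nonneg.2 hm) (sub_nonneg.2 hm)) (sub_nonneg.2 hm)]

end Cycle

end DistAlpha

theorem mainTheorem1 {V : Type*} [Fintype V] [DecidableEq V] (G : SimpleGraph V) (n : ℕ)
    (hcard : Fintype.card V = n) (hn : 4 ≤ n) (hconn : G.Connected)
    (α : ℝ) (hα0 : 0 ≤ α) (hα1 : α < 1) :
    (¬ Nonempty (G ≃g SimpleGraph.pathGraph n) →
      DistAlpha.spectralRadius α G ≤ DistAlpha.spectralRadius α (DistAlpha.broom n 3) ∧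
      DistAlpha.spectralRadius α (DistAlpha.broom n 3) <
        DistAlpha.spectralRadius α (SimpleGraph.pathGraph n) ∧
      (DistAlpha.spectralRadius α G = DistAlpha.spectralRadius α (DistAlpha.broom n 3) ↔
        Nonempty (G ≃g DistAlpha.broom n 3))) ∧
    -- the path is the unique connected graph with the largest value
    (SimpleGraph.pathGraph n).Connected ∧
    DistAlpha.spectralRadius α G ≤ DistAlpha.spectralRadius α (SimpleGraph.pathGraph n) ∧
    (DistAlpha.spectralRadius α G = DistAlpha.spectralRadius α (SimpleGraph.pathGraph n) ↔
      Nonempty (G ≃g SimpleGraph.pathGraph n)) ∧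
    -- the graph `B_{n,3}` is connected and not a path, hence it is the unique second largest
    (DistAlpha.broom n 3).Connected ∧
    ¬ Nonempty (DistAlpha.broom n 3 ≃g SimpleGraph.pathGraph n) := by
  open DistAlpha in
  have hV : Nontrivial V := Fintype.one_lt_card_iff_nontrivial.1 (by omega)
  have hF : Nontrivial (Fin n) := Fintype.one_lt_card_iff_nontrivial.1 (by simp; omega)
  have hBconn : (broom n 3).Connected := broom_three_connected hn
  have hBne : ¬ Nonempty (broom n 3 ≃g SimpleGraph.pathGraph n) := fun ⟨e⟩ =>
    pathGraph_not_branching n ((broom_three_branching hn).map_iso e)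
  have hPconn : (SimpleGraph.pathGraph n).Connected := by
    obtain ⟨m, rfl⟩ : ∃ m, n = m + 1 := ⟨n - 1, by omega⟩
    exact SimpleGraph.pathGraph_connected m
  have hlt : ¬ Nonempty (G ≃g SimpleGraph.pathGraph n) →
      spectralRadius α G < spectralRadius α (SimpleGraph.pathGraph n) :=
    spectralRadius_lt_pathGraph hα0 hα1 hconn hcard
  have heq : Nonempty (G ≃g SimpleGraph.pathGraph n) →
      spectralRadius α G = spectralRadius α (SimpleGraph.pathGraph n) := fun ⟨e⟩ =>
    spectralRadius_eq_of_iso hα1 hconn e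
  refine ⟨fun hne => ?_, hPconn, ?_, ⟨fun h => ?_, heq⟩, hBconn, hBne⟩
  · have heqB : Nonempty (G ≃g broom n 3) →
        spectralRadius α G = spectralRadius α (broom n 3) := fun ⟨e⟩ =>
      spectralRadius_eq_of_iso hα1 hconn e
    have hltB : ¬ Nonempty (G ≃g broom n 3) →
        spectralRadius α G < spectralRadius α (broom n 3) := fun h => by
      -- Without branching, `G` is a cycle, as paths are excluded by `hne`.
      by_cases hB : Branching G
      · exact spectralRadius_lt_broom_of_branching hα0 hα1 hconn hB hn hcard h
      · exact spectralRadius_lt_broom_of_not_branching hα1 hconn hB hn hcard hne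
    refine ⟨?_, spectralRadius_lt_pathGraph hα0 hα1 hBconn (by simp) hBne, ⟨fun h => ?_, heqB⟩⟩
    · by_cases h : Nonempty (G ≃g broom n 3)
      · exact (heqB h).le
      · exact (hltB h).le
    · by_contra hcon
      exact (hltB hcon).ne h
  · by_cases h : Nonempty (G ≃g SimpleGraph.pathGraph n)
    · exact (heq h).le
    · exact (hlt h).le
  · by_contra hcon
    exact (hlt hcon).ne h
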